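/- Let $\Pi$ be a finitely generated group, $k$ a field with $\mathrm{char}(k)\neq 2$, and $\mathcal{O}$ a complete discrete valuation ring with residue field $k$. Let $R$ be a complete local $\mathcal{O}$-algebra with residue field $k$; that is, $R$ is a commutative local ring, complete and separated for the $\mathfrak{m}_R$-adic topology (not necessarily Noetherian), with an $\mathcal{O}$-algebra structure and an identification $R/\mathfrak{m}_R = k$ of $\mathcal{O}$-algebras. A pseudo-$\mathrm{SL}_2$-representation of $\Pi$ over a commutative ring $A$ is a map $T:\Pi\to A$ such that, for all $g,g_1,g_2,g_3\in\Pi$: $T(1)=2$; $T(g_1g_2)=T(g_2g_1)$; $T(g_1)T(g_2)T(g_3)+T(g_1g_2g_3)+T(g_1g_3g_2)-T(g_1g_2)T(g_3)-T(g_2g_3)T(g_1)-T(g_1g_3)T(g_2)=0$; and $T(g)^2-T(g^2)=2$. Let $\overline{\rho}:\Pi\to \mathrm{SL}_2(k)$ be an absolutely irreducible representation, i.e. one that is irreducible over an algebraic closure of $k$. A deformation of $\overline{\rho}$ over $R$ is a homomorphism $\rho:\Pi\to\mathrm{SL}_2(R)$ with $\rho \bmod \mathfrak{m}_R=\overline{\rho}$.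 Two deformations $\rho,\rho'$ are strictly equivalent, $\rho\approx\rho'$, if there is $\gamma\in I_2+\mathrm{M}_2(\mathfrak{m}_R)$ with $\rho'(g)=\gamma^{-1}\rho(g)\gamma$ for all $g\in\Pi$. A deformation over $R$ of the pseudo-$\mathrm{SL}_2$-representation $\mathrm{tr}(\overline{\rho})$ is a pseudo-$\mathrm{SL}_2$-representation $T:\Pi\to R$ with $T\bmod\mathfrak{m}_R=\mathrm{tr}(\overline{\rho})$. Then $\rho\mapsto\mathrm{tr}(\rho)$ induces a well-defined bijection $$\{\rho:\Pi\to\mathrm{SL}_2(R)\mid \text{deformation of }\overline{\rho}\text{ over }R\}/\!\approx\ \longrightarrow\ \{T:\Pi\to R\mid\text{deformation of }\mathrm{tr}(\overline{\rho})\text{ over }R\}.$$ -/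

import Mathlib

open Matrix IsLocalRing
open scoped MatrixGroups

/-! ## Representations into general and special linear groups -/

/-- The linear representation of `Γ` on the space of column vectors `Kⁿ` attached to a
homomorphism `Γ → GL_n(K)`. -/
noncomputable def linearRep {Γ K n : Type*} [Group Γ] [Field K] [Fintype n] [DecidableEq n]
    (ρ : Γ →* GL n K) : Representation K Γ (n → K) :=
  (Matrix.toLinAlgEquiv' : Matrix n n K ≃ₐ[K] ((n → K) →ₗ[K] (n → K))).toRingEquiv.toMonoidHom.comp
    ((Units.coeHom (Matrix n n K)).comp ρ)

/-- A representation `ρ : Γ → GL_n(k)` over a field is absolutely irreducible if its composite with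
`GL_n(k) ⊆ GL_n(k̄)` is irreducible, for `k̄` an algebraic closure of `k`. -/
def IsAbsolutelyIrreducible {Γ k n : Type*} [Group Γ] [Field k] [Fintype n] [DecidableEq n]
    (ρ : Γ →* GL n k) : Prop :=
  (linearRep ((Matrix.GeneralLinearGroup.map (algebraMap k (AlgebraicClosure k))).comp
    ρ)).IsIrreducible

/-- Strict equivalence of representations over a local ring `A`: conjugacy by an element of
`I_n + M_n(𝔪_A)`. -/
def StrictlyEquivalent {Γ A n : Type*} [Group Γ] [CommRing A] [IsLocalRing A] [Fintype n]
    [DecidableEq n] (ρ ρ' : Γ →* GL n A) : Prop :=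
  ∃ γ : GL n A, (∀ i j, ((γ : Matrix n n A) - 1) i j ∈ maximalIdeal A) ∧
    ∀ g, ρ' g = γ⁻¹ * ρ g * γ

/-- A matrix is in `I_n + M_n(𝔪_A)` iff its reduction is the identity. -/
theorem residue_map_eq_one_iff {A n : Type*} [CommRing A] [IsLocalRing A] [Fintype n]
    [DecidableEq n] (γ : GL n A) :
    (∀ i j, ((γ : Matrix n n A) - 1) i j ∈ maximalIdeal A) ↔
      Matrix.GeneralLinearGroup.map (residue A) γ = 1 := by
  rw [Units.ext_iff, ← Matrix.ext_iff]
  refine forall_congr' fun i => forall_congr' fun j => ?_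
  rw [← residue_eq_zero_iff, Matrix.sub_apply, map_sub, sub_eq_zero]
  have h : residue A ((1 : Matrix n n A) i j) = (1 : Matrix n n (ResidueField A)) i j := by
    simp only [Matrix.one_apply]
    split_ifs <;> simp
  rw [h]
  rfl

theorem strictlyEquivalent_equivalence {Γ A n : Type*} [Group Γ] [CommRing A] [IsLocalRing A]
    [Fintype n] [DecidableEq n] :
    Equivalence (StrictlyEquivalent : (Γ →* GL n A) → (Γ →* GL n A) → Prop) where
  refl ρ := ⟨1, by simp, by simp⟩
  symm := by
    rintro ρ ρ' ⟨γ, h1, h2⟩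
    refine ⟨γ⁻¹, ?_, fun g => by rw [h2]; group⟩
    rw [residue_map_eq_one_iff] at h1 ⊢
    rw [map_inv, h1, inv_one]
  trans := by
    rintro ρ ρ' ρ'' ⟨γ, h1, h2⟩ ⟨δ, h3, h4⟩
    refine ⟨γ * δ, ?_, fun g => by rw [h4, h2]; group⟩
    rw [residue_map_eq_one_iff] at h1 h3 ⊢
    rw [map_mul, h1, h3, one_mul]

/-- A representation `Γ → SL_n(A)`, viewed as a representation `Γ → GL_n(A)`. -/
def toGLRep {Γ A n : Type*} [Group Γ] [CommRing A] [Fintype n] [DecidableEq n]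
    (ρ : Γ →* Matrix.SpecialLinearGroup n A) : Γ →* GL n A :=
  Matrix.SpecialLinearGroup.toGL.comp ρ

/-! ## Pseudo-`SL₂`-representations -/

/-- A pseudo-`SL₂`-representation of `Γ` over `A`. -/
structure PseudoSL2Rep (Γ A : Type*) [Group Γ] [CommRing A] where
  toFun : Γ → A
  map_one : toFun 1 = 2
  map_mul_comm : ∀ g₁ g₂, toFun (g₁ * g₂) = toFun (g₂ * g₁)
  three_term : ∀ g₁ g₂ g₃,
    toFun g₁ * toFun g₂ * toFun g₃ + toFun (g₁ * g₂ * g₃) + toFun (g₁ * g₃ * g₂)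
      - toFun (g₁ * g₂) * toFun g₃ - toFun (g₂ * g₃) * toFun g₁ - toFun (g₁ * g₃) * toFun g₂ = 0
  det_one : ∀ g, toFun g ^ 2 - toFun (g ^ 2) = 2

/-- The trace of a representation `Γ → SL₂(A)` is a pseudo-`SL₂`-representation. -/
def tracePseudoRep {Γ A : Type*} [Group Γ] [CommRing A] (ρ : Γ →* SL(2, A)) :
    PseudoSL2Rep Γ A where
  toFun g := Matrix.trace (ρ g : Matrix (Fin 2) (Fin 2) A)
  map_one := by simp
  map_mul_comm g₁ g₂ := by
    simp only [map_mul, Matrix.SpecialLinearGroup.coe_mul]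
    exact Matrix.trace_mul_comm _ _
  three_term g₁ g₂ g₃ := by
    simp only [map_mul, Matrix.SpecialLinearGroup.coe_mul, Matrix.trace_fin_two, Matrix.mul_apply,
      Fin.sum_univ_two]
    ring
  det_one g := by
    have h := (ρ g).det_coe
    rw [Matrix.det_fin_two] at h
    simp only [pow_two, map_mul, Matrix.SpecialLinearGroup.coe_mul, Matrix.trace_fin_two,
      Matrix.mul_apply, Fin.sum_univ_two]
    linear_combination 2 * h

/-! ## Deformations

`R` is a local ring, and its residue field is identified with `k` by an algebra structure of `k`
over `R` whose structure map `R → k` is reduction modulo `𝔪_R`. -/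

/-- The deformations over `R` of a representation `ρbar : Γ → SL₂(k)`: the representations
`Γ → SL₂(R)` whose reduction is `ρbar`. -/
abbrev RepDeformation {Γ k : Type*} (R : Type*) [Group Γ] [Field k] [CommRing R] [Algebra R k]
    (ρbar : Γ →* SL(2, k)) :=
  {ρ : Γ →* SL(2, R) // (Matrix.SpecialLinearGroup.map (algebraMap R k)).comp ρ = ρbar}

/-- The deformations over `R` of a pseudo-`SL₂`-representation `Tbar : Γ → k`: the
pseudo-`SL₂`-representations `Γ → R` whose reduction is `Tbar`. -/
abbrev PseudoDeformation {Γ k : Type*} (R : Type*) [Group Γ] [Field k] [CommRing R] [Algebra R k]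
    (Tbar : PseudoSL2Rep Γ k) :=
  {T : PseudoSL2Rep Γ R // ∀ g, algebraMap R k (T.toFun g) = Tbar.toFun g}

/-- Strict equivalence on the deformations of `ρbar` over `R`. -/
def strictSetoid {Γ k : Type*} (R : Type*) [Group Γ] [Field k] [CommRing R] [IsLocalRing R]
    [Algebra R k] (ρbar : Γ →* SL(2, k)) : Setoid (RepDeformation R ρbar) where
  r ρ ρ' := StrictlyEquivalent (toGLRep ρ.1) (toGLRep ρ'.1)
  iseqv := strictlyEquivalent_equivalence.comap fun ρ : RepDeformation R ρbar => toGLRep ρ.1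

/-- The trace of a deformation of `ρbar`, as a deformation of the trace of `ρbar`. -/
def traceDeformation {Γ k R : Type*} [Group Γ] [Field k] [CommRing R] [Algebra R k]
    {ρbar : Γ →* SL(2, k)} (ρ : RepDeformation R ρbar) :
    PseudoDeformation R (tracePseudoRep ρbar) :=
  ⟨tracePseudoRep ρ.1, fun g => by
    have h := DFunLike.congr_fun ρ.2 g
    simp [← h, tracePseudoRep, Matrix.trace_fin_two]⟩

/-- The map induced by `ρ ↦ tr ρ` on strict equivalence classes of deformations. -/
def traceMap {Γ k : Type*} (R : Type*) [Group Γ] [Field k] [CommRing R] [IsLocalRing R]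
    [Algebra R k] (ρbar : Γ →* SL(2, k)) :
    Quotient (strictSetoid R ρbar) → PseudoDeformation R (tracePseudoRep ρbar) :=
  Quotient.lift traceDeformation (by
    rintro ⟨ρ, hρ⟩ ⟨ρ', hρ'⟩ ⟨γ, -, h⟩
    simp only [traceDeformation, tracePseudoRep, Subtype.mk.injEq, PseudoSL2Rep.mk.injEq]
    funext g
    have hg : (ρ' g : Matrix (Fin 2) (Fin 2) R)
        = ((γ⁻¹ : GL (Fin 2) R) : Matrix (Fin 2) (Fin 2) R) * (ρ g : Matrix (Fin 2) (Fin 2) R)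
          * (γ : Matrix (Fin 2) (Fin 2) R) :=
      congrArg Units.val (h g)
    rw [hg, Matrix.trace_mul_comm, ← mul_assoc, Units.mul_inv, one_mul])

/-! Everything is transferred to the group algebra `R[Γ]`. By Burnside over the algebraic closure,
an absolutely irreducible `ρbar` maps `R[Γ]` onto `M₂(k)`.

Injectivity: by Nakayama every deformation maps `R[Γ]` onto `M₂(R)`. Since the trace form on
matrices is nondegenerate, the kernel of such a surjection depends only on its trace. Two
deformations with equal trace thus have equal kernels, and an explicit intertwiner between them can
be chosen to reduce to the identity (`AlgHom.exists_conj_of_trace_eq`).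

Surjectivity: extend `T` linearly to `R[Γ]` and divide by the radical of `(x, y) ↦ T(xy)`. On the
quotient `E`, nondegeneracy turns the three-term identity into a polarized Cayley–Hamilton identity,
so `E` behaves like a quaternion algebra. It maps onto `M₂(k)`. Lifting `diag(1, -1)` and the swap
matrix, making them orthogonal, and rescaling by square roots supplied by Hensel's lemma (2 is a
unit) gives `a, b` with `a² = b² = 1` and `ab = -ba`. These split `E`
(`IsQuaternionTrace.exists_algHom_of_residue`), and `Γ → E → M₂(R)` is the required deformation. -/

/-! ### Burnside's theorem and descent from the algebraic closure -/

/-- **Burnside's theorem**: an irreducible representation over an algebraically closed field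
generates the full endomorphism algebra. -/
theorem Representation.asAlgebraHom_surjective_of_isAlgClosed {Γ K V : Type*} [Group Γ] [Field K]
    [IsAlgClosed K] [AddCommGroup V] [Module K V] [FiniteDimensional K V]
    (σ : Representation K Γ V) [σ.IsIrreducible] :
    Function.Surjective σ.asAlgebraHom := by
  intro f
  have : FiniteDimensional K σ.asModule := inferInstanceAs (FiniteDimensional K V)
  have hb : Function.Bijective
      (algebraMap K (Module.End (MonoidAlgebra K Γ) σ.asModule)) :=
    IsSimpleModule.algebraMap_end_bijective_of_isAlgClosed K
  -- By Schur's lemma the commutant is `K`, so any `K`-linear `f` commutes with it and the density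
  -- theorem applies on a basis.
  let F : Module.End (Module.End (MonoidAlgebra K Γ) σ.asModule) σ.asModule :=
    { toFun := fun v => σ.asModuleEquiv.symm (f (σ.asModuleEquiv v))
      map_add' := fun v w => by simp
      map_smul' := fun e v => by
        obtain ⟨c, rfl⟩ := hb.2 e
        have h : ∀ w : σ.asModule,
            algebraMap K (Module.End (MonoidAlgebra K Γ) σ.asModule) c • w = c • w := fun w => rfl
        simp only [h, map_smul, RingHom.id_apply] }
  obtain ⟨b⟩ : Nonempty (Module.Basis (Fin (Module.finrank K V)) K V) := ⟨Module.finBasis K V⟩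
  classical
  obtain ⟨r, hr⟩ := jacobson_density F (Finset.univ.image fun i => σ.asModuleEquiv.symm (b i))
  refine ⟨r, b.ext fun i => ?_⟩
  have h := hr (σ.asModuleEquiv.symm (b i))
    (Finset.mem_coe.2 (Finset.mem_image_of_mem _ (Finset.mem_univ i)))
  have h' := congrArg σ.asModuleEquiv h
  rw [Representation.asModuleEquiv_map_smul] at h'
  simpa [F] using h'.symm

theorem span_range_eq_top_of_isIrreducible {Γ K n : Type*} [Group Γ] [Field K]
    [IsAlgClosed K] [Fintype n] [DecidableEq n] (σ : Γ →* GL n K)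
    (h : (linearRep σ).IsIrreducible) :
    Submodule.span K (Set.range fun g => (σ g : Matrix n n K)) = ⊤ := by
  refine eq_top_iff.2 fun Y _ => ?_
  obtain ⟨r, hr⟩ := (linearRep σ).asAlgebraHom_surjective_of_isAlgClosed (Matrix.toLinAlgEquiv' Y)
  have hY : Y = MonoidAlgebra.lift K (Matrix n n K) Γ ((Units.coeHom _).comp σ) r := by
    apply (Matrix.toLinAlgEquiv' : Matrix n n K ≃ₐ[K] ((n → K) →ₗ[K] (n → K))).injective
    rw [← hr, Representation.asAlgebraHom_def, MonoidAlgebra.lift_apply,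
      MonoidAlgebra.lift_apply, map_finsuppSum]
    refine Finsupp.sum_congr fun g _ => ?_
    rw [map_smul]
    rfl
  rw [hY, MonoidAlgebra.lift_apply]
  exact Submodule.sum_mem _ fun g _ => Submodule.smul_mem _ _ (Submodule.subset_span ⟨g, rfl⟩)

/-- The matrices of an absolutely irreducible representation span the full matrix algebra. -/
theorem IsAbsolutelyIrreducible.span_range_eq_top {Γ k n : Type*} [Group Γ] [Field k]
    [Fintype n] [DecidableEq n] {ρ : Γ →* GL n k} (h : IsAbsolutelyIrreducible ρ) :
    Submodule.span k (Set.range fun g => (ρ g : Matrix n n k)) = ⊤ := by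
  by_contra hne
  obtain ⟨f, hf, hle⟩ := Submodule.exists_le_ker_of_lt_top _ (lt_top_iff_ne_top.2 hne)
  let K := AlgebraicClosure k
  -- `F` is the extension of scalars of a form `f` vanishing on the span; Burnside over `K` forces
  -- `F = 0`, hence `f = 0`.
  let F : Matrix n n K →ₗ[K] K := ∑ i, ∑ j,
    algebraMap k K (f (Matrix.single i j 1)) • Matrix.entryLinearMap K K i j
  have hF : ∀ M : Matrix n n k, F (M.map (algebraMap k K)) = algebraMap k K (f M) := by
    intro M
    conv_rhs => rw [Matrix.matrix_eq_sum_single M]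
    simp only [F, LinearMap.sum_apply, LinearMap.smul_apply, Matrix.entryLinearMap_apply,
      Matrix.map_apply, map_sum, smul_eq_mul]
    refine Finset.sum_congr rfl fun i _ => Finset.sum_congr rfl fun j _ => ?_
    rw [← map_mul]
    congr 1
    rw [mul_comm, ← smul_eq_mul (M i j), ← map_smul, Matrix.smul_single, smul_eq_mul, mul_one]
  have htop := span_range_eq_top_of_isIrreducible _ h
  have hker : (⊤ : Submodule K (Matrix n n K)) ≤ LinearMap.ker F := by
    rw [← htop, Submodule.span_le]
    rintro _ ⟨g, rfl⟩
    have h0 : f (ρ g : Matrix n n k) = 0 := hle (Submodule.subset_span ⟨g, rfl⟩)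
    have := hF (ρ g)
    rw [h0, map_zero] at this
    exact this
  refine hf (LinearMap.ext fun M => ?_)
  have := hF M
  rw [LinearMap.mem_ker.1 (hker Submodule.mem_top)] at this
  exact (algebraMap k K).injective (by simpa using this.symm)

/-! ### Quaternion traces and splitting by a standard basis -/

/-- A linear form on an `R`-algebra with the formal properties of the trace on a quaternion algebra:
the associated bilinear form is nondegenerate, and the multilinear three-term identity holds. -/
structure IsQuaternionTrace {R E : Type*} [CommRing R] [Ring E] [Algebra R E]
    (t : E →ₗ[R] R) : Prop where
  trace_one : t 1 = 2
  trace_mul_comm : ∀ x y, t (x * y) = t (y * x)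
  three_term : ∀ x y z, t x * t y * t z + t (x * y * z) + t (x * z * y)
      - t (x * y) * t z - t (y * z) * t x - t (x * z) * t y = 0
  eq_zero : ∀ x, (∀ y, t (x * y) = 0) → x = 0

namespace IsQuaternionTrace

variable {R E : Type*} [CommRing R] [Ring E] [Algebra R E] {t : E →ₗ[R] R}

/-- The polarized Cayley–Hamilton identity for trace-zero elements. -/
theorem mul_add_mul (h : IsQuaternionTrace t) {x y : E} (hx : t x = 0) (hy : t y = 0) :
    x * y + y * x = t (x * y) • (1 : E) := by
  rw [← sub_eq_zero]
  -- Paired with `z`, the difference is the three-term identity after the terms containing `t x` or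
  -- `t y` drop out.
  refine h.eq_zero _ fun z => ?_
  have h1 := h.three_term x y z
  have h2 : t (x * z * y) = t (y * x * z) := by rw [h.trace_mul_comm, mul_assoc]
  simp only [sub_mul, add_mul, map_sub, map_add, smul_mul_assoc, one_mul, map_smul, smul_eq_mul]
  rw [hx, hy, h2] at h1
  linear_combination h1

theorem mul_self [Invertible (2 : R)] (h : IsQuaternionTrace t) {x : E} (hx : t x = 0) :
    x * x = (⅟2 * t (x * x)) • (1 : E) := by
  rw [mul_smul, ← h.mul_add_mul hx hx, ← two_smul R, smul_smul, invOf_mul_self, one_smul]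

/-- Coordinates with respect to a standard basis `1, a, b, ab` with `a² = b² = 1`. -/
theorem eq_combination [Invertible (2 : R)] (h : IsQuaternionTrace t) {a b : E} (ha : t a = 0)
    (hb : t b = 0) (hab : t (a * b) = 0) (haa : a * a = 1) (hbb : b * b = 1) (z : E) :
    z = ⅟(2 : R) • (t z • (1 : E) + t (a * z) • a + t (b * z) • b - t (a * b * z) • (a * b)) := by
  have hba : b * a = -(a * b) := by
    have := h.mul_add_mul ha hb
    rw [hab, zero_smul] at this
    exact eq_neg_of_add_eq_zero_right this
  have haab : a * (a * b) = b := by rw [← mul_assoc, haa, one_mul]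
  have hbab : b * (a * b) = -a := by rw [← mul_assoc, hba, neg_mul, mul_assoc, hbb, mul_one]
  have haba : a * b * a = -b := by rw [mul_assoc, hba, mul_neg, haab]
  have habb : a * b * b = a := by rw [mul_assoc, hbb, mul_one]
  have habab : a * b * (a * b) = -1 := by rw [mul_assoc, hbab, mul_neg, haa]
  have h2 : ⅟(2 : R) * 2 = 1 := invOf_mul_self 2
  set w : E := z - ⅟(2 : R) •
    (t z • (1 : E) + t (a * z) • a + t (b * z) • b - t (a * b * z) • (a * b)) with hw
  have hba0 : t (b * a) = 0 := by rw [hba, map_neg, hab, neg_zero]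
  have w0 : t w = 0 := by
    simp only [hw, map_sub, map_add, map_smul, smul_eq_mul, h.trace_one, ha, hb, hab]
    linear_combination (-t z) * h2
  have wa : t (a * w) = 0 := by
    simp only [hw, mul_sub, mul_add, mul_smul_comm, map_sub, map_add, map_smul, smul_eq_mul,
      mul_one, haa, haab, h.trace_one, ha, hb, hab]
    linear_combination (-t (a * z)) * h2
  have wb : t (b * w) = 0 := by
    simp only [hw, mul_sub, mul_add, mul_smul_comm, map_sub, map_add, map_smul, smul_eq_mul,
      mul_one, hbb, hbab, h.trace_one, ha, hb, hba0, map_neg]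
    linear_combination (-t (b * z)) * h2
  have wab : t (a * b * w) = 0 := by
    simp only [hw, mul_sub, mul_add, mul_smul_comm, map_sub, map_add, map_smul, smul_eq_mul,
      mul_one, haba, habb, habab, h.trace_one, ha, hb, hab, map_neg]
    linear_combination (-t (a * b * z)) * h2
  -- The error `w` is orthogonal to `1, a, b, ab`, so it anticommutes with `a`, `b` and `ab`. The
  -- first two make it commute with `ab`; hence `2w(ab) = 0`, and `ab` is invertible.
  have ca := h.mul_add_mul ha w0
  have cb := h.mul_add_mul hb w0
  have cab := h.mul_add_mul hab w0
  rw [wa, zero_smul] at ca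
  rw [wb, zero_smul] at cb
  rw [wab, zero_smul] at cab
  have hcomm : a * b * w = w * (a * b) := by
    rw [mul_assoc, eq_neg_of_add_eq_zero_left cb, mul_neg, ← mul_assoc,
      eq_neg_of_add_eq_zero_left ca, neg_mul, neg_neg, mul_assoc]
  have hz : w * (a * b) = 0 := by
    have : (2 : R) • (w * (a * b)) = 0 := by rw [two_smul]; nth_rw 1 [← hcomm]; exact cab
    rw [← one_smul R (w * (a * b)), ← h2, mul_smul, this, smul_zero]
  have : w = 0 := by
    calc w = -(w * (a * b) * (a * b)) := by rw [mul_assoc, habab, mul_neg, mul_one, neg_neg]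
      _ = 0 := by rw [hz, zero_mul, neg_zero]
  exact sub_eq_zero.1 this

/-- A standard basis `1, a, b, ab` with `a² = b² = 1` splits the quaternion algebra. -/
theorem exists_algHom [Invertible (2 : R)] (h : IsQuaternionTrace t) {a b : E} (ha : t a = 0)
    (hb : t b = 0) (hab : t (a * b) = 0) (haa : a * a = 1) (hbb : b * b = 1) :
    ∃ ψ : E →ₐ[R] Matrix (Fin 2) (Fin 2) R, (∀ z, (ψ z).trace = t z) ∧
      ∀ z, ψ z = ⅟(2 : R) • !![t z + t (a * z), t (b * z) - t (a * b * z);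
        t (b * z) + t (a * b * z), t z - t (a * z)] := by
  have hba : b * a = -(a * b) := by
    have := h.mul_add_mul ha hb
    rw [hab, zero_smul] at this
    exact eq_neg_of_add_eq_zero_right this
  have haab : a * (a * b) = b := by rw [← mul_assoc, haa, one_mul]
  have hbab : b * (a * b) = -a := by rw [← mul_assoc, hba, neg_mul, mul_assoc, hbb, mul_one]
  have haba : a * b * a = -b := by rw [mul_assoc, hba, mul_neg, haab]
  have habb : a * b * b = a := by rw [mul_assoc, hbb, mul_one]
  have habab : a * b * (a * b) = -1 := by rw [mul_assoc, hbab, mul_neg, haa]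
  have hba0 : t (b * a) = 0 := by rw [hba, map_neg, hab, neg_zero]
  have h2 : ⅟(2 : R) * 2 = 1 := invOf_mul_self 2
  -- These are the coordinates of `eq_combination` under `a ↦ diag(1, -1)`, `b ↦ !![0, 1; 1, 0]`,
  -- `ab ↦ !![0, 1; -1, 0]`.
  obtain ⟨F, hFz⟩ : ∃ F : E →ₗ[R] Matrix (Fin 2) (Fin 2) R, ∀ z, F z =
      ⅟(2 : R) • !![t z + t (a * z), t (b * z) - t (a * b * z);
        t (b * z) + t (a * b * z), t z - t (a * z)] :=
    ⟨{toFun := fun z => ⅟(2 : R) • !![t z + t (a * z), t (b * z) - t (a * b * z);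
        t (b * z) + t (a * b * z), t z - t (a * z)]
      map_add' := fun x y => by
        ext i j
        fin_cases i <;> fin_cases j <;> simp [mul_add] <;> ring
      map_smul' := fun c x => by
        ext i j
        fin_cases i <;> fin_cases j <;> simp <;> ring }, fun z => rfl⟩
  have hF : ∀ p q r s : R, F (p • 1 + q • a + r • b + s • (a * b)) =
      !![p + q, r + s; r - s, p - q] := by
    intro p q r s
    have e0 : t (p • 1 + q • a + r • b + s • (a * b)) = 2 * p := by
      simp only [map_add, map_smul, smul_eq_mul, h.trace_one, ha, hb, hab]
      ring
    have e1 : t (a * (p • 1 + q • a + r • b + s • (a * b))) = 2 * q := by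
      simp only [mul_add, mul_smul_comm, mul_one, haa, haab, map_add, map_smul, smul_eq_mul,
        h.trace_one, ha, hb, hab]
      ring
    have e2 : t (b * (p • 1 + q • a + r • b + s • (a * b))) = 2 * r := by
      simp only [mul_add, mul_smul_comm, mul_one, hbb, hbab, map_add, map_smul, smul_eq_mul,
        h.trace_one, ha, hb, hba0, map_neg]
      ring
    have e3 : t (a * b * (p • 1 + q • a + r • b + s • (a * b))) = -(2 * s) := by
      simp only [mul_add, mul_smul_comm, mul_one, haba, habb, habab, map_add, map_smul,
        smul_eq_mul, h.trace_one, ha, hb, hab, map_neg]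
      ring
    rw [hFz, e0, e1, e2, e3, Matrix.smul_of, Matrix.smul_cons, Matrix.smul_cons]
    simp only [Matrix.smul_cons, Matrix.smul_empty, smul_eq_mul]
    have key : ∀ x : R, ⅟2 * (2 * x) = x :=
      fun x => invOf_mul_cancel_left (2 : R) x
    rw [← mul_add, ← mul_sub, sub_neg_eq_add, ← sub_eq_add_neg, ← mul_add, ← mul_sub, key, key, key,
      key]
  have hsurj : ∀ z : E, ∃ p q r s : R, z = p • (1 : E) + q • a + r • b + s • (a * b) := fun z =>
    ⟨⅟2 * t z, ⅟2 * t (a * z), ⅟2 * t (b * z), -(⅟2 * t (a * b * z)), by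
      conv_lhs => rw [h.eq_combination ha hb hab haa hbb z]
      module⟩
  have hone : F 1 = 1 := by
    have := hF 1 0 0 0
    simp only [one_smul, zero_smul, add_zero, sub_zero] at this
    rw [this, Matrix.one_fin_two]
  have hmul : ∀ x y, F (x * y) = F x * F y := by
    intro x y
    obtain ⟨p, q, r, s, rfl⟩ := hsurj x
    obtain ⟨p', q', r', s', rfl⟩ := hsurj y
    have : (p • (1 : E) + q • a + r • b + s • (a * b)) *
        (p' • (1 : E) + q' • a + r' • b + s' • (a * b)) =
        (p * p' + q * q' + r * r' - s * s') • (1 : E) +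
        (p * q' + q * p' - r * s' + s * r') • a +
        (p * r' + r * p' + q * s' - s * q') • b +
        (p * s' + s * p' + q * r' - r * q') • (a * b) := by
      simp only [mul_add, add_mul, smul_mul_smul_comm, mul_one, one_mul, haa, hbb, haab, hbab, haba,
        habb, habab, hba]
      module
    rw [this, hF, hF, hF, Matrix.mul_fin_two]
    congr! 3 <;> ring_nf
  refine ⟨AlgHom.ofLinearMap F hone hmul, fun z => ?_, hFz⟩
  rw [Matrix.trace_fin_two, AlgHom.ofLinearMap_apply, hFz]
  simp only [Matrix.smul_apply, Matrix.of_apply, Matrix.cons_val', Matrix.cons_val_zero,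
    Matrix.cons_val_one, Matrix.cons_val_fin_one, smul_eq_mul]
  linear_combination t z * h2

end IsQuaternionTrace

/-! ### Surjections onto matrix algebras over a local ring -/

/-- Two surjections onto a matrix algebra with the same trace have the same kernel. -/
theorem AlgHom.eq_zero_of_trace_eq {R A n : Type*} [CommRing R] [Ring A] [Algebra R A]
    [Fintype n] [DecidableEq n] {f f' : A →ₐ[R] Matrix n n R} (hf' : Function.Surjective f')
    (ht : ∀ x, (f x).trace = (f' x).trace) {z : A} (hz : f z = 0) : f' z = 0 := by
  refine Matrix.ext_iff_trace_mul_right.2 fun Y => ?_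
  obtain ⟨y, rfl⟩ := hf' Y
  rw [← map_mul, ← ht, map_mul, hz, zero_mul, zero_mul]

section Residue

variable {R k : Type*} [CommRing R] [IsLocalRing R] [Field k] [Algebra R k]

theorem mem_maximalIdeal_iff_algebraMap_eq_zero (hφ : Function.Surjective (algebraMap R k))
    (x : R) : x ∈ maximalIdeal R ↔ algebraMap R k x = 0 := by
  rw [← ker_eq_maximalIdeal (algebraMap R k) hφ, RingHom.mem_ker]

theorem isUnit_iff_algebraMap_ne_zero (hφ : Function.Surjective (algebraMap R k))
    (x : R) : IsUnit x ↔ algebraMap R k x ≠ 0 := by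
  rw [← notMem_maximalIdeal, Ne, mem_maximalIdeal_iff_algebraMap_eq_zero hφ]

/-- Square roots of elements congruent to `1`, away from residue characteristic two. -/
theorem exists_mul_self_eq_of_algebraMap_eq_one [IsAdicComplete (maximalIdeal R) R]
    (hφ : Function.Surjective (algebraMap R k)) (h2 : IsUnit (2 : R)) {α : R}
    (hα : algebraMap R k α = 1) : ∃ u : R, u * u = α ∧ algebraMap R k u = 1 := by
  -- Hensel's lemma at the approximate root `1`, where the derivative is the unit `2`.
  obtain ⟨u, hu, hu1⟩ := HenselianRing.is_henselian (I := maximalIdeal R)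
    (Polynomial.X ^ 2 - Polynomial.C α) (Polynomial.monic_X_pow_sub_C α two_ne_zero) 1
    (by simp [mem_maximalIdeal_iff_algebraMap_eq_zero hφ, hα])
    (by simpa [one_add_one_eq_two] using h2.map (Ideal.Quotient.mk (maximalIdeal R)))
  refine ⟨u, ?_, ?_⟩
  · simpa [Polynomial.IsRoot, sub_eq_zero, sq] using hu
  · rwa [mem_maximalIdeal_iff_algebraMap_eq_zero hφ, map_sub, map_one, sub_eq_zero] at hu1

/-- A subalgebra-image that is everything modulo the maximal ideal is everything. -/
theorem AlgHom.surjective_of_mapMatrix_surjective {A n : Type*} [Ring A] [Algebra R A]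
    [Fintype n] [DecidableEq n] (hφ : Function.Surjective (algebraMap R k))
    (f : A →ₐ[R] Matrix n n R)
    (hf : Function.Surjective (((Algebra.ofId R k).mapMatrix).comp f)) :
    Function.Surjective f := by
  suffices h : (⊤ : Submodule R (Matrix n n R)) ≤ LinearMap.range f.toLinearMap by
    intro M
    exact h (Submodule.mem_top (x := M))
  -- Nakayama: only finite generation of `M_n(R)` is needed, so `R` may be non-Noetherian.
  refine Submodule.le_of_le_smul_of_le_jacobson_bot (I := maximalIdeal R) Module.Finite.fg_top
    (IsLocalRing.maximalIdeal_le_jacobson ⊥) fun M _ => ?_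
  obtain ⟨x, hx⟩ := hf ((Algebra.ofId R k).mapMatrix M)
  rw [← sub_add_cancel M (f x), add_comm]
  refine Submodule.add_mem_sup ⟨x, rfl⟩ ?_
  rw [Matrix.matrix_eq_sum_single (M - f x)]
  refine Submodule.sum_mem _ fun i _ => Submodule.sum_mem _ fun j _ => ?_
  rw [← mul_one ((M - f x) i j), ← smul_eq_mul, ← Matrix.smul_single]
  refine Submodule.smul_mem_smul ?_ Submodule.mem_top
  rw [mem_maximalIdeal_iff_algebraMap_eq_zero hφ, Matrix.sub_apply, map_sub, sub_eq_zero]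
  exact (congrFun (congrFun hx i) j).symm

/-- Two surjections onto a matrix algebra over a local ring with the same trace and the same
reduction are conjugate by a matrix reducing to the identity. -/
theorem AlgHom.exists_conj_of_trace_eq {A n : Type*} [Ring A] [Algebra R A]
    [Fintype n] [DecidableEq n] [Nonempty n] (hφ : Function.Surjective (algebraMap R k))
    {f f' : A →ₐ[R] Matrix n n R} (hf : Function.Surjective f) (hf' : Function.Surjective f')
    (ht : ∀ x, (f x).trace = (f' x).trace)
    (hff' : ((Algebra.ofId R k).mapMatrix).comp f = ((Algebra.ofId R k).mapMatrix).comp f') :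
    ∃ γ : GL n R, (∀ i j, ((γ : Matrix n n R) - 1) i j ∈ maximalIdeal R) ∧
      ∀ z, f' z * (γ : Matrix n n R) = (γ : Matrix n n R) * f z := by
  obtain ⟨o⟩ := ‹Nonempty n›
  choose x hx using fun i => hf (Matrix.single i o 1)
  -- Since `f (x i)` carries the basis vector `e_o` to `e_i`, an intertwiner may send `e_i` to `f'
  -- (x i) e_o`; that vector is column `i` of `M`.
  let M : Matrix n n R := ∑ i, f' (x i) * Matrix.single o i 1
  have hM : (Algebra.ofId R k).mapMatrix M = 1 := by
    simp only [M, map_sum, map_mul]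
    have h1 : ∀ i, (Algebra.ofId R k).mapMatrix (f' (x i)) = Matrix.single i o 1 := fun i => by
      rw [← AlgHom.comp_apply, ← hff', AlgHom.comp_apply, hx]
      ext a b
      simp [Matrix.single_apply]
    have h2 : ∀ i, (Algebra.ofId R k).mapMatrix (Matrix.single o i 1) = Matrix.single o i 1 :=
      fun i => by
        ext a b
        simp [Matrix.single_apply]
    simp only [h1, h2, Matrix.single_mul_single_same, mul_one]
    exact Matrix.sum_single_one
  have hdet : IsUnit M.det := by
    rw [isUnit_iff_algebraMap_ne_zero hφ, RingHom.map_det]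
    have : (algebraMap R k).mapMatrix M = 1 := hM
    rw [this, Matrix.det_one]
    exact one_ne_zero
  refine ⟨Matrix.GeneralLinearGroup.mk'' M hdet, fun i j => ?_, fun z => ?_⟩
  · rw [mem_maximalIdeal_iff_algebraMap_eq_zero hφ]
    have : (Algebra.ofId R k).mapMatrix (M - 1) = 0 := by rw [map_sub, hM, map_one, sub_self]
    exact congrFun (congrFun this i) j
  · change f' z * M = M * f z
    have h1 : ∀ i, f' z * f' (x i) = ∑ j, f z j i • f' (x j) := fun i => by
      -- This element lies in `ker f`, hence in `ker f'`; that is what makes `M` commute with the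
      -- two actions.
      have : f (z * x i - ∑ j, f z j i • x j) = 0 := by
        simp only [map_sub, map_mul, map_sum, map_smul, hx, sub_eq_zero]
        ext a b
        simp [Matrix.sum_apply, Matrix.single_apply, Matrix.mul_apply, ite_and]
      have := AlgHom.eq_zero_of_trace_eq hf' ht this
      simpa only [map_sub, map_mul, map_sum, map_smul, sub_eq_zero] using this
    have h2 : ∀ j, Matrix.single o j 1 * f z = ∑ i, f z j i • Matrix.single o i (1 : R) :=
      fun j => by
        ext a b
        simp [Matrix.sum_apply, Matrix.single_apply, Matrix.mul_apply, ite_and]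
    simp only [M, Finset.mul_sum, Finset.sum_mul, ← mul_assoc, h1]
    simp only [mul_assoc, h2, Finset.mul_sum, smul_mul_assoc, mul_smul_comm]
    exact Finset.sum_comm

end Residue

/-! ### Lifting a standard basis from the residue field -/

namespace IsQuaternionTrace

variable {R E k : Type*} [CommRing R] [IsLocalRing R] [Field k] [Algebra R k] [Ring E]
  [Algebra R E] {t : E →ₗ[R] R}

/-- A trace-zero element whose reduction squares to `1` can be rescaled to square to `1`. -/
theorem exists_smul_mul_self_eq_one [IsAdicComplete (maximalIdeal R) R] [Invertible (2 : R)]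
    (h : IsQuaternionTrace t) (hφ : Function.Surjective (algebraMap R k))
    (π : E →ₐ[R] Matrix (Fin 2) (Fin 2) k) (hπt : ∀ x, (π x).trace = algebraMap R k (t x))
    {x : E} (hx : t x = 0) (hπx : π x * π x = 1) :
    ∃ v : R, (v • x) * (v • x) = 1 ∧ π (v • x) = π x := by
  -- By `mul_self`, `x²` is the scalar `½ t(x²)`; it reduces to half the trace of the identity, so
  -- it has a square root reducing to `1`.
  have hα : algebraMap R k (⅟2 * t (x * x)) = 1 := by
    rw [map_mul, ← hπt, map_mul, hπx, Matrix.trace_one, Fintype.card_fin, Nat.cast_ofNat,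
      ← map_ofNat (algebraMap R k) 2, ← map_mul, invOf_mul_self, map_one]
  obtain ⟨u, hu, hu1⟩ := exists_mul_self_eq_of_algebraMap_eq_one hφ (isUnit_of_invertible 2) hα
  obtain ⟨u, rfl⟩ : IsUnit u := by
    rw [isUnit_iff_algebraMap_ne_zero hφ, hu1]
    exact one_ne_zero
  refine ⟨(u⁻¹ : Rˣ), ?_, ?_⟩
  · rw [smul_mul_smul_comm, h.mul_self hx, smul_smul, ← hu, mul_mul_mul_comm]
    simp
  · have : algebraMap R k (u⁻¹ : Rˣ) = 1 := by
      have := congrArg (algebraMap R k) u.inv_mul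
      rwa [map_mul, hu1, mul_one, map_one] at this
    rw [map_smul, algebra_compatible_smul k, this, one_smul]

/-- A quaternion trace over a complete local ring whose reduction is the trace of a matrix algebra
is the trace of a representation lifting the reduction. -/
theorem exists_algHom_of_residue [IsAdicComplete (maximalIdeal R) R]
    (h : IsQuaternionTrace t) (hφ : Function.Surjective (algebraMap R k)) (h2 : IsUnit (2 : R))
    (π : E →ₐ[R] Matrix (Fin 2) (Fin 2) k) (hπ : Function.Surjective π)
    (hπt : ∀ x, (π x).trace = algebraMap R k (t x)) :
    ∃ ψ : E →ₐ[R] Matrix (Fin 2) (Fin 2) R, (∀ z, (ψ z).trace = t z) ∧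
      ((Algebra.ofId R k).mapMatrix).comp ψ = π := by
  let := h2.invertible
  have hi : ⅟(2 : R) * 2 = 1 := invOf_mul_self 2
  obtain ⟨a₀, ha₀⟩ := hπ !![1, 0; 0, -1]
  obtain ⟨b₀, hb₀⟩ := hπ !![0, 1; 1, 0]
  have hta₀ : algebraMap R k (t a₀) = 0 := by
    rw [← hπt, ha₀, Matrix.trace_fin_two]
    simp
  have hπa₁ : π (a₀ - (⅟2 * t a₀) • 1) = !![1, 0; 0, -1] := by
    rw [map_sub, map_smul, algebra_compatible_smul k, map_mul, hta₀, ha₀]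
    simp
  obtain ⟨v, hva, hvπ⟩ := h.exists_smul_mul_self_eq_one hφ π hπt (x := a₀ - (⅟2 * t a₀) • 1)
    (by
      rw [map_sub, map_smul, h.trace_one, smul_eq_mul]
      linear_combination (-t a₀) * hi)
    (by rw [hπa₁, Matrix.mul_fin_two, Matrix.one_fin_two]; simp)
  set a := v • (a₀ - (⅟2 * t a₀) • 1) with ha
  have hta : t a = 0 := by
    rw [ha, map_smul, map_sub, map_smul, h.trace_one, smul_eq_mul, smul_eq_mul]
    linear_combination (-v * t a₀) * hi
  have hπa : π a = !![1, 0; 0, -1] := hvπ.trans hπa₁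
  have htb₀ : algebraMap R k (t b₀) = 0 := by
    rw [← hπt, hb₀, Matrix.trace_fin_two]
    simp
  have htab₀ : algebraMap R k (t (a * b₀)) = 0 := by
    rw [← hπt, map_mul, hπa, hb₀, Matrix.mul_fin_two, Matrix.trace_fin_two]
    simp
  -- Gram–Schmidt against `1` and `a`: both coefficients vanish in `k`, so the reduction is
  -- unchanged.
  have hπb₁ : π (b₀ - (⅟2 * t b₀) • 1 - (⅟2 * t (a * b₀)) • a) = !![0, 1; 1, 0] := by
    rw [map_sub, map_sub, map_smul, map_smul, algebra_compatible_smul k,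
      algebra_compatible_smul k (_ * t (a * b₀)), map_mul, map_mul, htb₀, htab₀, hb₀]
    simp
  have htb₁ : t (b₀ - (⅟2 * t b₀) • 1 - (⅟2 * t (a * b₀)) • a) = 0 := by
    rw [map_sub, map_sub, map_smul, map_smul, h.trace_one, hta, smul_eq_mul, smul_eq_mul]
    linear_combination (-t b₀) * hi
  have htab₁ : t (a * (b₀ - (⅟2 * t b₀) • 1 - (⅟2 * t (a * b₀)) • a)) = 0 := by
    simp only [mul_sub, mul_smul_comm, mul_one, map_sub, map_smul, smul_eq_mul, hta, hva, h.trace_one]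
    linear_combination (-t (a * b₀)) * hi
  obtain ⟨w, hwb, hwπ⟩ := h.exists_smul_mul_self_eq_one hφ π hπt htb₁
    (by rw [hπb₁, Matrix.mul_fin_two, Matrix.one_fin_two]; simp)
  set b := w • (b₀ - (⅟2 * t b₀) • 1 - (⅟2 * t (a * b₀)) • a) with hb
  have hπb : π b = !![0, 1; 1, 0] := hwπ.trans hπb₁
  have htb : t b = 0 := by rw [hb, map_smul, htb₁, smul_zero]
  have htab : t (a * b) = 0 := by rw [hb, mul_smul_comm, map_smul, htab₁, smul_zero]
  obtain ⟨ψ, hψt, hψ⟩ := h.exists_algHom hta htb htab hva hwb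
  refine ⟨ψ, hψt, AlgHom.ext fun z => ?_⟩
  -- Modulo `𝔪_R` the formula for `ψ z` involves the traces of `π z` against `1`, `π a`, `π b`, `π
  -- (a * b)`, which recover its four entries.
  have hik : algebraMap R k ⅟2 * 2 = 1 := by
    rw [← map_ofNat (algebraMap R k) 2, ← map_mul, hi, map_one]
  ext i j
  rw [AlgHom.comp_apply, hψ]
  fin_cases i <;> fin_cases j <;>
    simp only [AlgHom.mapMatrix_apply, Matrix.map_apply, Matrix.smul_apply, Matrix.of_apply,
      Matrix.cons_val', Matrix.cons_val_zero, Matrix.cons_val_one, Matrix.cons_val_fin_one,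
      smul_eq_mul, Fin.zero_eta, Fin.mk_one, Algebra.ofId_apply, map_mul, map_add, map_sub, ← hπt,
      hπa, hπb, Matrix.trace_fin_two, Matrix.mul_apply, Fin.sum_univ_two]
  · linear_combination (π z 0 0) * hik
  · linear_combination (π z 0 1) * hik
  · linear_combination (π z 1 0) * hik
  · linear_combination (π z 1 1) * hik

end IsQuaternionTrace

/-! ### The radical quotient and the linear extension of a pseudo-representation -/

/-- A multiplicatively symmetric trace form satisfying the three-term identity becomes
nondegenerate on the quotient by its radical. -/
theorem exists_quotient_isQuaternionTrace {R A : Type*} [CommRing R] [Ring A] [Algebra R A]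
    (t : A →ₗ[R] R) (h1 : t 1 = 2) (hc : ∀ x y, t (x * y) = t (y * x))
    (h3 : ∀ x y z, t x * t y * t z + t (x * y * z) + t (x * z * y)
      - t (x * y) * t z - t (y * z) * t x - t (x * z) * t y = 0) :
    ∃ (I : Ideal A) (_ : I.IsTwoSided) (s : A ⧸ I →ₗ[R] R),
      (∀ x, x ∈ I ↔ ∀ y, t (x * y) = 0) ∧ (∀ x, s (Ideal.Quotient.mk I x) = t x) ∧
      IsQuaternionTrace s := by
  let I : Ideal A :=
    { carrier := {x | ∀ y, t (x * y) = 0}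
      add_mem' := fun {x y} hx hy z => by rw [add_mul, map_add, hx, hy, add_zero]
      zero_mem' := fun z => by rw [zero_mul, map_zero]
      smul_mem' := fun c x hx z => by
        rw [smul_eq_mul, mul_assoc, hc, mul_assoc]
        exact hx _ }
  have hI : ∀ x, x ∈ I ↔ ∀ y, t (x * y) = 0 := fun x => Iff.rfl
  have : I.IsTwoSided := ⟨fun {x} c hx z => by rw [mul_assoc]; exact hx _⟩
  have ht : ∀ x ∈ I, t x = 0 := fun x hx => by rw [← mul_one x]; exact hx 1
  let s₀ : A ⧸ I →+ R := QuotientAddGroup.lift I.toAddSubgroup t.toAddMonoidHom ht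
  have hs₀ : ∀ x, s₀ (Ideal.Quotient.mk I x) = t x := fun x => rfl
  let s : A ⧸ I →ₗ[R] R :=
    { s₀ with
      map_smul' := fun c x => by
        obtain ⟨x, rfl⟩ := Ideal.Quotient.mk_surjective x
        change s₀ (Ideal.Quotient.mk I (c • x)) = c • s₀ (Ideal.Quotient.mk I x)
        rw [hs₀, hs₀, map_smul] }
  have hs : ∀ x, s (Ideal.Quotient.mk I x) = t x := fun x => rfl
  refine ⟨I, this, s, hI, hs, ?_, fun x y => ?_, fun x y z => ?_, fun x hx => ?_⟩
  · rw [← map_one (Ideal.Quotient.mk I), hs, h1]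
  · obtain ⟨x, rfl⟩ := Ideal.Quotient.mk_surjective x
    obtain ⟨y, rfl⟩ := Ideal.Quotient.mk_surjective y
    rw [← map_mul, ← map_mul, hs, hs, hc]
  · obtain ⟨x, rfl⟩ := Ideal.Quotient.mk_surjective x
    obtain ⟨y, rfl⟩ := Ideal.Quotient.mk_surjective y
    obtain ⟨z, rfl⟩ := Ideal.Quotient.mk_surjective z
    simp only [← map_mul (Ideal.Quotient.mk I), hs]
    exact h3 x y z
  · obtain ⟨x, rfl⟩ := Ideal.Quotient.mk_surjective x
    rw [Ideal.Quotient.eq_zero_iff_mem, hI]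
    intro y
    rw [← hs, map_mul]
    exact hx _

namespace PseudoSL2Rep

variable {Γ R : Type*} [Group Γ] [CommRing R] (T : PseudoSL2Rep Γ R)

@[ext]
theorem ext {T T' : PseudoSL2Rep Γ R} (h : ∀ g, T.toFun g = T'.toFun g) : T = T' := by
  cases T
  cases T'
  simpa [funext_iff] using h

/-- The linear extension of a pseudo-representation to the group algebra. -/
noncomputable def linearExtension : MonoidAlgebra R Γ →ₗ[R] R :=
  (MonoidAlgebra.basis Γ R).constr R T.toFun

theorem linearExtension_single (g : Γ) (r : R) :
    T.linearExtension (MonoidAlgebra.single g r) = r * T.toFun g := by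
  have : MonoidAlgebra.single g r = r • MonoidAlgebra.basis Γ R g := by
    simp [MonoidAlgebra.basis_apply]
  rw [this, map_smul, linearExtension, Module.Basis.constr_basis, smul_eq_mul]

theorem linearExtension_one : T.linearExtension 1 = 2 := by
  rw [MonoidAlgebra.one_def, linearExtension_single, one_mul, T.map_one]

theorem linearExtension_mul_comm (x y : MonoidAlgebra R Γ) :
    T.linearExtension (x * y) = T.linearExtension (y * x) := by
  induction x using MonoidAlgebra.induction_linear with
  | zero => simp
  | add x x' hx hx' => rw [add_mul, mul_add, map_add, map_add, hx, hx']
  | single g r =>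
    induction y using MonoidAlgebra.induction_linear with
    | zero => simp
    | add y y' hy hy' => rw [add_mul, mul_add, map_add, map_add, hy, hy']
    | single g' r' =>
      rw [MonoidAlgebra.single_mul_single, MonoidAlgebra.single_mul_single,
        linearExtension_single, linearExtension_single, T.map_mul_comm, mul_comm r]

/-- Each term is linear in `x`, `y` and `z` separately, so group elements suffice. The quadratic
condition `det_one` does not extend this way and is used only on group elements. -/
theorem linearExtension_three_term (x y z : MonoidAlgebra R Γ) :
    T.linearExtension x * T.linearExtension y * T.linearExtension z
      + T.linearExtension (x * y * z) + T.linearExtension (x * z * y)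
      - T.linearExtension (x * y) * T.linearExtension z
      - T.linearExtension (y * z) * T.linearExtension x
      - T.linearExtension (x * z) * T.linearExtension y = 0 := by
  induction x using MonoidAlgebra.induction_linear with
  | zero => simp
  | add x x' hx hx' =>
    simp only [add_mul, map_add]
    linear_combination hx + hx'
  | single g r =>
    induction y using MonoidAlgebra.induction_linear with
    | zero => simp
    | add y y' hy hy' =>
      simp only [add_mul, mul_add, map_add]
      linear_combination hy + hy'
    | single g' r' =>
      induction z using MonoidAlgebra.induction_linear with
      | zero => simp
      | add z z' hz hz' =>
        simp only [add_mul, mul_add, map_add]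
        linear_combination hz + hz'
      | single g'' r'' =>
        simp only [MonoidAlgebra.single_mul_single, linearExtension_single]
        linear_combination r * r' * r'' * T.three_term g g' g''

end PseudoSL2Rep

/-! ### Group algebra representations and the two halves of the bijection -/

section GroupAlgebra

variable {Γ R k : Type*} [Group Γ] [CommRing R] [Field k] [Algebra R k]

/-- The `R`-algebra homomorphism from the group algebra to a matrix algebra attached to a
representation into `SL_n`. -/
noncomputable def Matrix.SpecialLinearGroup.liftMonoidAlgebra (R : Type*) {S n : Type*}
    [CommRing R] [CommRing S] [Algebra R S] [Fintype n] [DecidableEq n]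
    (ρ : Γ →* Matrix.SpecialLinearGroup n S) : MonoidAlgebra R Γ →ₐ[R] Matrix n n S :=
  MonoidAlgebra.lift R (Matrix n n S) Γ
    ((Units.coeHom (Matrix n n S)).comp (toGLRep ρ))

open Matrix.SpecialLinearGroup

theorem Matrix.SpecialLinearGroup.liftMonoidAlgebra_single {S n : Type*}
    [CommRing S] [Algebra R S] [Fintype n] [DecidableEq n]
    (ρ : Γ →* Matrix.SpecialLinearGroup n S) (g : Γ) (r : R) :
    liftMonoidAlgebra R ρ (MonoidAlgebra.single g r) = r • (ρ g : Matrix n n S) :=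
  MonoidAlgebra.lift_single _ _ _

/-- The matrices span over `k`, and every scalar of `k` lifts to `R`. -/
theorem IsAbsolutelyIrreducible.liftMonoidAlgebra_surjective {n : Type*} [Fintype n]
    [DecidableEq n] {ρ : Γ →* Matrix.SpecialLinearGroup n k}
    (h : IsAbsolutelyIrreducible (toGLRep ρ))
    (hφ : Function.Surjective (algebraMap R k)) :
    Function.Surjective (liftMonoidAlgebra R ρ) := by
  intro Y
  have hY : Y ∈ Submodule.span k (Set.range fun g => (toGLRep ρ g : Matrix n n k)) := by
    rw [h.span_range_eq_top]
    exact Submodule.mem_top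
  induction hY using Submodule.span_induction with
  | mem Y hY =>
    obtain ⟨g, rfl⟩ := hY
    exact ⟨MonoidAlgebra.single g 1, by rw [liftMonoidAlgebra_single, one_smul]; rfl⟩
  | zero => exact ⟨0, map_zero _⟩
  | add X Y _ _ hX hY =>
    obtain ⟨x, rfl⟩ := hX
    obtain ⟨y, rfl⟩ := hY
    exact ⟨x + y, map_add _ _ _⟩
  | smul c Y _ hY =>
    obtain ⟨y, rfl⟩ := hY
    obtain ⟨c, rfl⟩ := hφ c
    exact ⟨c • y, by rw [map_smul, algebra_compatible_smul k]⟩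

theorem trace_liftMonoidAlgebra {S : Type*} [CommRing S] [Algebra R S] (ρ : Γ →* SL(2, S))
    (T : PseudoSL2Rep Γ R) (h : ∀ g, algebraMap R S (T.toFun g) = (ρ g : Matrix (Fin 2) (Fin 2) S).trace)
    (x : MonoidAlgebra R Γ) :
    (liftMonoidAlgebra R ρ x).trace = algebraMap R S (T.linearExtension x) := by
  induction x using MonoidAlgebra.induction_linear with
  | zero => simp
  | add x y hx hy => rw [map_add, Matrix.trace_add, hx, hy, map_add, map_add]
  | single g r =>
    rw [liftMonoidAlgebra_single, T.linearExtension_single, Matrix.trace_smul, map_mul, h,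
      Algebra.smul_def]

theorem mapMatrix_comp_liftMonoidAlgebra {n : Type*} [Fintype n] [DecidableEq n]
    (ρ : Γ →* Matrix.SpecialLinearGroup n R) :
    ((Algebra.ofId R k).mapMatrix).comp (liftMonoidAlgebra R ρ) =
      liftMonoidAlgebra R ((Matrix.SpecialLinearGroup.map (algebraMap R k)).comp ρ) := by
  refine MonoidAlgebra.algHom_ext (fun g => ?_) (Subsingleton.elim _ _)
  rw [AlgHom.comp_apply, liftMonoidAlgebra_single, liftMonoidAlgebra_single, one_smul, one_smul]
  rfl

variable [IsLocalRing R]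

/-- Deformations of an absolutely irreducible representation with the same trace are strictly
equivalent. -/
theorem strictlyEquivalent_of_trace_eq {ρbar : Γ →* SL(2, k)}
    (h : IsAbsolutelyIrreducible (toGLRep ρbar)) (hφ : Function.Surjective (algebraMap R k))
    (ρ ρ' : RepDeformation R ρbar) (ht : tracePseudoRep ρ.1 = tracePseudoRep ρ'.1) :
    StrictlyEquivalent (toGLRep ρ.1) (toGLRep ρ'.1) := by
  have hred : ∀ σ : RepDeformation R ρbar,
      ((Algebra.ofId R k).mapMatrix).comp (liftMonoidAlgebra R σ.1) =
        liftMonoidAlgebra R ρbar := fun σ => by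
    rw [mapMatrix_comp_liftMonoidAlgebra, σ.2]
  have hsurj : ∀ σ : RepDeformation R ρbar, Function.Surjective (liftMonoidAlgebra R σ.1) :=
    fun σ => AlgHom.surjective_of_mapMatrix_surjective (k := k) hφ _
      (by rw [hred]; exact h.liftMonoidAlgebra_surjective hφ)
  -- The order `ρ'`, `ρ` is deliberate: it yields `ργ = γρ'`, that is, `ρ' = γ⁻¹ργ`.
  obtain ⟨γ, hγ, hconj⟩ := AlgHom.exists_conj_of_trace_eq hφ (hsurj ρ') (hsurj ρ)
    (fun x => by
      rw [trace_liftMonoidAlgebra ρ'.1 (tracePseudoRep ρ'.1) fun g => rfl,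
        trace_liftMonoidAlgebra ρ.1 (tracePseudoRep ρ.1) fun g => rfl, ht])
    ((hred ρ').trans (hred ρ).symm)
  refine ⟨γ, hγ, fun g => ?_⟩
  rw [mul_assoc, eq_inv_mul_iff_mul_eq]
  refine Units.ext ?_
  have := hconj (MonoidAlgebra.single g 1)
  rw [liftMonoidAlgebra_single, liftMonoidAlgebra_single, one_smul, one_smul] at this
  exact this.symm

/-- Every deformation of the trace of an absolutely irreducible representation is the trace of a
deformation. -/
theorem exists_tracePseudoRep_eq [IsAdicComplete (maximalIdeal R) R] {ρbar : Γ →* SL(2, k)}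
    (h : IsAbsolutelyIrreducible (toGLRep ρbar)) (hφ : Function.Surjective (algebraMap R k))
    (h2 : IsUnit (2 : R)) (T : PseudoDeformation R (tracePseudoRep ρbar)) :
    ∃ ρ : RepDeformation R ρbar, tracePseudoRep ρ.1 = T.1 := by
  obtain ⟨I, hI, s, hmem, hs, hquat⟩ := exists_quotient_isQuaternionTrace T.1.linearExtension
    T.1.linearExtension_one T.1.linearExtension_mul_comm T.1.linearExtension_three_term
  have htr := trace_liftMonoidAlgebra ρbar T.1 T.2
  have hsurj := h.liftMonoidAlgebra_surjective hφ
  -- The radical of `T` dies in `M₂(k)` because the trace form there is nondegenerate; hence `ρbar`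
  -- factors through the quotient.
  have hker : ∀ x ∈ I, liftMonoidAlgebra R ρbar x = 0 := fun x hx => by
    refine Matrix.ext_iff_trace_mul_right.2 fun Y => ?_
    obtain ⟨y, rfl⟩ := hsurj Y
    rw [← map_mul, htr, (hmem x).1 hx, map_zero, zero_mul, Matrix.trace_zero]
  let π := Ideal.Quotient.liftₐ I (liftMonoidAlgebra R ρbar) hker
  have hπ : ∀ x, π (Ideal.Quotient.mk I x) = liftMonoidAlgebra R ρbar x := fun x => rfl
  obtain ⟨ψ, hψt, hψ⟩ := hquat.exists_algHom_of_residue hφ h2 π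
    (fun Y => by
      obtain ⟨y, rfl⟩ := hsurj Y
      exact ⟨_, hπ y⟩)
    (fun x => by
      obtain ⟨x, rfl⟩ := Ideal.Quotient.mk_surjective x
      rw [hπ, hs, htr])
  let f : MonoidAlgebra R Γ →ₐ[R] Matrix (Fin 2) (Fin 2) R := ψ.comp (Ideal.Quotient.mkₐ R I)
  have hft : ∀ g, (f (MonoidAlgebra.single g 1)).trace = T.1.toFun g := fun g => by
    have : (f (MonoidAlgebra.single g 1)).trace = T.1.linearExtension _ := (hψt _).trans (hs _)
    rw [this, T.1.linearExtension_single, one_mul]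
  -- For 2×2 matrices `tr(M)² - tr(M²) = 2 det M`, so `det_one` gives determinant `1` once `2` is
  -- cancelled.
  have hdet : ∀ g, (f (MonoidAlgebra.single g 1)).det = 1 := fun g => by
    have hsq : (f (MonoidAlgebra.single g 1) * f (MonoidAlgebra.single g 1)).trace =
        T.1.toFun (g ^ 2) := by
      rw [← map_mul, MonoidAlgebra.single_mul_single, one_mul, hft, sq]
    have hd := T.1.det_one g
    rw [← hsq, ← hft, Matrix.trace_fin_two, Matrix.trace_fin_two] at hd
    simp only [Matrix.mul_apply, Fin.sum_univ_two] at hd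
    refine h2.mul_left_cancel ?_
    rw [Matrix.det_fin_two]
    linear_combination hd
  let ρ : Γ →* SL(2, R) :=
    { toFun := fun g => ⟨f (MonoidAlgebra.single g 1), hdet g⟩
      map_one' := Subtype.ext (map_one f)
      map_mul' := fun g g' => Subtype.ext (by
        change f (MonoidAlgebra.single (g * g') 1) =
          f (MonoidAlgebra.single g 1) * f (MonoidAlgebra.single g' 1)
        rw [← map_mul, MonoidAlgebra.single_mul_single, one_mul]) }
  refine ⟨⟨ρ, MonoidHom.ext fun g => Subtype.ext ?_⟩, PseudoSL2Rep.ext hft⟩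
  have := DFunLike.congr_fun hψ (Ideal.Quotient.mk I (MonoidAlgebra.single g 1))
  rw [hπ, liftMonoidAlgebra_single, one_smul] at this
  exact this

end GroupAlgebra

/-- `O` is a complete discrete valuation ring with residue field `k` (identified through the
surjection `O → k`), and `R` is a complete local `O`-algebra with residue field `k` (identified
through the map `R → k`, which is compatible with `O → k` and hence surjective, so that its kernel
is the maximal ideal of `R`). -/
theorem theorem2p2p1 {Γ O k R : Type*} [Group Γ] [Group.FG Γ]
    [CommRing O] [IsDomain O] [IsDiscreteValuationRing O] [IsAdicComplete (maximalIdeal O) O]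
    [Field k] [Algebra O k] (hOk : Function.Surjective (algebraMap O k))
    (hk : ringChar k ≠ 2)
    [CommRing R] [IsLocalRing R] [IsAdicComplete (maximalIdeal R) R]
    [Algebra O R] [Algebra R k] [IsScalarTower O R k]
    (ρbar : Γ →* SL(2, k)) (hρbar : IsAbsolutelyIrreducible (toGLRep ρbar)) :
    Function.Bijective (traceMap R ρbar) := by
  have hφ : Function.Surjective (algebraMap R k) := fun c => by
    obtain ⟨x, rfl⟩ := hOk c
    exact ⟨algebraMap O R x, (IsScalarTower.algebraMap_apply O R k x).symm⟩
  have h2 : IsUnit (2 : R) := by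
    rw [isUnit_iff_algebraMap_ne_zero hφ, map_ofNat]
    exact Ring.two_ne_zero hk
  constructor
  · rintro ⟨ρ⟩ ⟨ρ'⟩ heq
    exact Quotient.sound (strictlyEquivalent_of_trace_eq hρbar hφ ρ ρ' (congrArg Subtype.val heq))
  · intro T
    obtain ⟨ρ, hρ⟩ := exists_tracePseudoRep_eq hρbar hφ h2 T
    exact ⟨Quotient.mk _ ρ, Subtype.ext hρ⟩
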